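/- Compact spaces are understood to be Hausdorff. A *compactological set* is a triple $(X,\mathscr C,(\tau_K)_{K\in\mathscr C})$ consisting of a set $X$, a non-empty collection $\mathscr C\subseteq\mathcal P(X)$ and, for each $K\in\mathscr C$, a compact topology $\tau_K$ on $K$ such that 1. $\bigcup_{K\in\mathscr C}K=X$; 2. for all $K_1,K_2\in\mathscr C$ there is $K_3\in\mathscr C$ with $K_1\cup K_2\subseteq K_3$; 3. $\tau_{K_2}=\tau_{K_1}|_{K_2}$ for all $K_1,K_2\in\mathscr C$ with $K_2\subseteq K_1$; 4. if $K_1\in\mathscr C$ and $K_2\subseteq K_1$ is compact in $(K_1,\tau_{K_1})$, then $K_2\in\mathscr C$. Let $\mathsf{Cmp}$ be the category of compactological sets, in which a morphism from $(X,\mathscr C,(\tau_K)_{K\in\mathscr C})$ to $(X',\mathscr C',(\tau_{K'})_{K'\in\mathscr C'})$ is a map $f\colon X\to X'$ such that for every $K\in\mathscr C$ one has $f(K)\in\mathscr C'$ and the restriction $f|_K\colon(K,\tau_K)\to(f(K),\tau_{f(K)})$ is continuous. For an uncountable strong limit cardinal $\kappa$ let $\mathsf{Cmp}_\kappa$ be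 the full subcategory of those compactological sets for which $|K|<\kappa$ for all $K\in\mathscr C$. A category is called *coregular* if it has all finite colimits, if for every morphism $f\colon C\to D$ the cokernel pair $D\rightrightarrows D\sqcup_C D$ admits an equalizer, and if regular monomorphisms (that is, equalizers of some parallel pair) are stable under pushout. Then the category $\mathsf{Cmp}$ is coregular, and so is $\mathsf{Cmp}_\kappa$ for every uncountable strong limit cardinal $\kappa$. -/

import Mathlib

open CategoryTheory CategoryTheory.Limits

universe v u

/-- A compactology on a set `X`: a non-empty collection `sets` of subsets of `X`, each endowed with
a compact Hausdorff topology, which covers `X`, is upwards filtering, has coherent topologies and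
is stable under compact subsets. -/
structure Compactology (X : Type u) where
  /-- The members of the compactology. -/
  sets : Set (Set X)
  /-- The topology carried by each member. -/
  top : ∀ K : sets, TopologicalSpace (K : Set X)
  nonempty : sets.Nonempty
  compactSpace : ∀ K : sets, @CompactSpace (K : Set X) (top K)
  t2Space : ∀ K : sets, @T2Space (K : Set X) (top K)
  covers : ⋃₀ sets = Set.univ
  directed : ∀ K₁ ∈ sets, ∀ K₂ ∈ sets, ∃ K₃ ∈ sets, K₁ ⊆ K₃ ∧ K₂ ⊆ K₃
  coherent : ∀ (K₁ K₂ : sets) (h : (K₂ : Set X) ⊆ (K₁ : Set X)),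
    top K₂ = (top K₁).induced (Set.inclusion h)
  mem_of_isCompact : ∀ (K : sets) (L : Set X), L ⊆ (K : Set X) →
    @IsCompact (K : Set X) (top K) (Subtype.val ⁻¹' L) → L ∈ sets

/-- A compactological set: a set together with a compactology on it. -/
structure Cmp : Type (u + 1) where
  carrier : Type u
  str : Compactology carrier

namespace Cmp

/-- The inclusion between two members of a compactology is continuous. -/
theorem continuous_inclusion (C : Cmp.{u}) (K L : C.str.sets)
    (h : (K : Set C.carrier) ⊆ (L : Set C.carrier)) :
    @Continuous _ _ (C.str.top K) (C.str.top L) (Set.inclusion h) :=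
  continuous_iff_le_induced.mpr (C.str.coherent L K h).le

/-- A morphism of compactological sets: a map `f` such that, for each member `K` of the compactology
of the source, `f '' K` is a member of the compactology of the target and the restriction
`K → f '' K` of `f` is continuous. -/
@[ext]
structure Hom (C D : Cmp.{u}) where
  toFun : C.carrier → D.carrier
  image_mem : ∀ K ∈ C.str.sets, toFun '' K ∈ D.str.sets
  continuous_restrict : ∀ (K : Set C.carrier) (hK : K ∈ C.str.sets),
    @Continuous K (toFun '' K : Set D.carrier)
      (C.str.top ⟨K, hK⟩) (D.str.top ⟨toFun '' K, image_mem K hK⟩)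
      (Set.imageFactorization toFun K)

/-- The identity morphism. -/
def Hom.id (C : Cmp.{u}) : Hom C C where
  toFun := fun x => x
  image_mem := fun K hK => by rwa [Set.image_id']
  continuous_restrict := fun K hK =>
    C.continuous_inclusion ⟨K, hK⟩ ⟨(fun x => x) '' K, by rwa [Set.image_id']⟩
      (Set.image_id' K).ge

/-- Composition of morphisms. -/
def Hom.comp {C D E : Cmp.{u}} (f : Hom C D) (g : Hom D E) : Hom C E where
  toFun := fun x => g.toFun (f.toFun x)
  image_mem := fun K hK => by
    rw [← Set.image_image]
    exact g.image_mem _ (f.image_mem K hK)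
  continuous_restrict := fun K hK => by
    have hmem := g.image_mem _ (f.image_mem K hK)
    have hEq : g.toFun '' (f.toFun '' K) = (fun x => g.toFun (f.toFun x)) '' K :=
      Set.image_image _ _ _
    have hmem' : (fun x => g.toFun (f.toFun x)) '' K ∈ E.str.sets := by rwa [← hEq]
    exact @Continuous.comp _ _ _ (C.str.top ⟨K, hK⟩) (D.str.top ⟨_, f.image_mem K hK⟩)
      (E.str.top ⟨_, hmem'⟩) _ _
      (@Continuous.comp _ _ _ (D.str.top ⟨_, f.image_mem K hK⟩) (E.str.top ⟨_, hmem⟩)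
        (E.str.top ⟨_, hmem'⟩) _ _ (E.continuous_inclusion ⟨_, hmem⟩ ⟨_, hmem'⟩ hEq.le)
        (g.continuous_restrict _ (f.image_mem K hK)))
      (f.continuous_restrict K hK)

/-- The category of compactological sets. -/
instance : Category.{u} Cmp.{u} where
  Hom := Hom
  id := Hom.id
  comp := Hom.comp

/-- `C` is `κ`-compactological if every member of its compactology has cardinality `< κ`. -/
def isSmall (κ : Cardinal.{u}) : ObjectProperty Cmp.{u} :=
  fun C => ∀ K ∈ C.str.sets, Cardinal.mk K < κ

end Cmp

/-- The category of `κ`-compactological sets, a full subcategory of `Cmp`. -/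
abbrev CmpSmall (κ : Cardinal.{u}) : Type (u + 1) := (Cmp.isSmall κ).FullSubcategory

/-- A category is coregular (the dual of `CategoryTheory.Regular`) if it has finite colimits, every
cokernel pair has an equalizer, and regular monomorphisms are stable under pushout. -/
structure IsCoregular (C : Type u) [Category.{v} C] : Prop where
  hasFiniteColimits : HasFiniteColimits C
  hasEqualizer_of_isCokernelPair : ∀ {X Y Z : C} {f : X ⟶ Y} {g₁ g₂ : Y ⟶ Z},
    IsPushout f f g₁ g₂ → HasEqualizer g₁ g₂
  regularMono_isStableUnderCobaseChange :
    (MorphismProperty.regularMono C).IsStableUnderCobaseChange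

/-! A map is a morphism exactly when it carries every member to a plot, a map that factors
continuously through some member. Compactness and the Hausdorff property make equality of two plots
a closed condition and let plots descend along continuous surjections from compact to Hausdorff
spaces. New objects come from an `Atlas`: quotients of compact Hausdorff spaces by closed
equivalence relations, patched together.

The key point is that regular monomorphisms are the closed embeddings `IsClosedEmb`
(`isRegularMono_iff`). Equalizers are closed embeddings; conversely, gluing two copies of the target
along a closed embedding (`exists_amalgam`) gives a pair that it equalizes. For stability under
pushout, the same gluing gives a commutative square whose leg is a closed embedding; this leg
factors through the leg of the pushout, and a first factor of a closed embedding is one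
(`IsClosedEmb.of_comp`). Finite colimits are quotients of disjoint unions by the least suitable
closed equivalence relation (`exists_isColimit`).

All constructions use only subquotients and finite disjoint unions of members, so they respect the
bound `κ`; both cases follow from `isCoregular_of_fullyFaithful`. -/

namespace Cmp

/-! ### Members and plots -/

/-- A member of a compactology, regarded as a topological space. -/
def El (X : Cmp.{u}) (K : X.str.sets) : Type u := (K : Set X.carrier)

instance (X : Cmp.{u}) (K : X.str.sets) : TopologicalSpace (X.El K) := X.str.top K

instance (X : Cmp.{u}) (K : X.str.sets) : CompactSpace (X.El K) := X.str.compactSpace K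

instance (X : Cmp.{u}) (K : X.str.sets) : T2Space (X.El K) := X.str.t2Space K

/-- A point of a member. -/
def El.mk {X : Cmp.{u}} {K : X.str.sets} (x : X.carrier) (hx : x ∈ (K : Set X.carrier)) : X.El K :=
  (⟨x, hx⟩ : (K : Set X.carrier))

/-- The inclusion of a member into the underlying set. -/
def El.val {X : Cmp.{u}} {K : X.str.sets} (x : X.El K) : X.carrier := Subtype.val x

/-- The inclusion of a member into a larger one. -/
def El.incl {X : Cmp.{u}} {K L : X.str.sets} (h : (K : Set X.carrier) ⊆ L) (x : X.El K) : X.El L :=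
  Set.inclusion h x

theorem El.val_injective {X : Cmp.{u}} {K : X.str.sets} :
    Function.Injective (El.val : X.El K → X.carrier) := Subtype.val_injective

theorem El.val_mem {X : Cmp.{u}} {K : X.str.sets} (x : X.El K) : x.val ∈ (K : Set X.carrier) :=
  Subtype.property x

theorem El.isInducing_incl {X : Cmp.{u}} {K L : X.str.sets} (h : (K : Set X.carrier) ⊆ L) :
    Topology.IsInducing (El.incl h : X.El K → X.El L) :=
  ⟨X.str.coherent L K h⟩

/-- A map from a topological space to a compactological set which factors continuously through
some member. -/
def Plot (X : Cmp.{u}) {T : Type*} [TopologicalSpace T] (φ : T → X.carrier) : Prop :=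
  ∃ (M : X.str.sets) (g : T → X.El M), Continuous g ∧ ∀ t, (g t).val = φ t

theorem plot_val (X : Cmp.{u}) (K : X.str.sets) : X.Plot (El.val : X.El K → X.carrier) :=
  ⟨K, id, continuous_id, fun _ => rfl⟩

section Plot

variable {X Y : Cmp.{u}} {S T : Type*} [TopologicalSpace S] [TopologicalSpace T]

theorem Plot.comp_continuous {φ : T → X.carrier} (hφ : X.Plot φ) {h : S → T}
    (hh : Continuous h) : X.Plot (fun s => φ (h s)) := by
  obtain ⟨M, g, hg, hgφ⟩ := hφ
  exact ⟨M, g ∘ h, hg.comp hh, fun t => hgφ _⟩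

theorem exists_le_le (K L : X.str.sets) :
    ∃ M : X.str.sets, (K : Set X.carrier) ⊆ M ∧ (L : Set X.carrier) ⊆ M := by
  obtain ⟨M, hM, h⟩ := X.str.directed K K.2 L L.2
  exact ⟨⟨M, hM⟩, h⟩

theorem exists_le_finite {J : Type*} [Finite J] (K : J → X.str.sets) :
    ∃ M : X.str.sets, ∀ j, (K j : Set X.carrier) ⊆ M := by
  classical
  have := Fintype.ofFinite J
  suffices ∀ s : Finset J, ∃ M : X.str.sets, ∀ j ∈ s, (K j : Set X.carrier) ⊆ M by
    obtain ⟨M, hM⟩ := this Finset.univ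
    exact ⟨M, fun j => hM j (Finset.mem_univ j)⟩
  intro s
  induction s using Finset.induction_on with
  | empty => exact ⟨⟨_, X.str.nonempty.some_mem⟩, by simp⟩
  | insert a s _ ih =>
    obtain ⟨M, hM⟩ := ih
    obtain ⟨N, h₁, h₂⟩ := exists_le_le (K a) M
    refine ⟨N, fun j hj => ?_⟩
    rcases Finset.mem_insert.mp hj with rfl | hj
    · exact h₁
    · exact (hM j hj).trans h₂

theorem exists_mem (x : X.carrier) : ∃ K : X.str.sets, x ∈ (K : Set X.carrier) := by
  have hx : x ∈ ⋃₀ X.str.sets := X.str.covers ▸ Set.mem_univ x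
  obtain ⟨K, hK, hxK⟩ := hx
  exact ⟨⟨K, hK⟩, hxK⟩

theorem Plot.exists_lift_ge {φ : T → X.carrier} (hφ : X.Plot φ) (K : X.str.sets) :
    ∃ (M : X.str.sets) (g : T → X.El M), (K : Set X.carrier) ⊆ M ∧ Continuous g ∧
      ∀ t, (g t).val = φ t := by
  obtain ⟨M, g, hg, hgφ⟩ := hφ
  obtain ⟨N, h₁, h₂⟩ := exists_le_le K M
  exact ⟨N, fun t => El.incl h₂ (g t), h₁, (El.isInducing_incl h₂).continuous.comp hg, hgφ⟩

/-- The member through which a plot factors does not matter: any two lie in a third, which induces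
both topologies. -/
theorem Plot.continuous_codRestrict {φ : T → X.carrier} (hφ : X.Plot φ) (K : X.str.sets)
    (h : ∀ t, φ t ∈ (K : Set X.carrier)) :
    Continuous (fun t => El.mk (φ t) (h t)) := by
  obtain ⟨M, g, hM, hg, hgφ⟩ := hφ.exists_lift_ge K
  rw [(El.isInducing_incl hM).continuous_iff]
  convert hg using 1
  funext t
  exact El.val_injective (hgφ t).symm

/-- Inside a common larger member, `K` is compact and hence closed. -/
theorem isClosed_preimage_val (K L : X.str.sets) :
    IsClosed ((El.val : X.El L → X.carrier) ⁻¹' (K : Set X.carrier)) := by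
  obtain ⟨M, hK, hL⟩ := exists_le_le K L
  have h : IsClosed (Set.range (El.incl hK : X.El K → X.El M)) :=
    (isCompact_range (El.isInducing_incl hK).continuous).isClosed
  convert h.preimage (El.isInducing_incl hL).continuous using 1
  ext x
  constructor
  · intro hx
    exact ⟨⟨x.val, hx⟩, rfl⟩
  · rintro ⟨y, hy⟩
    have : y.val = x.val := congrArg El.val hy
    exact Set.mem_preimage.mpr (this ▸ y.val_mem)

theorem Plot.isClosed_preimage {φ : T → X.carrier} (hφ : X.Plot φ) (K : X.str.sets) :
    IsClosed (φ ⁻¹' (K : Set X.carrier)) := by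
  obtain ⟨M, g, hg, hgφ⟩ := hφ
  convert (isClosed_preimage_val K M).preimage hg using 1
  ext t
  simp [hgφ]

theorem mem_of_isClosed (K : X.str.sets) {L : Set X.carrier} (hL : L ⊆ K)
    (h : IsClosed ((El.val : X.El K → X.carrier) ⁻¹' L)) : L ∈ X.str.sets :=
  X.str.mem_of_isCompact K L hL h.isCompact

theorem Plot.image_mem [CompactSpace T] {φ : T → X.carrier} (hφ : X.Plot φ) {C : Set T}
    (hC : IsClosed C) : φ '' C ∈ X.str.sets := by
  obtain ⟨M, g, hg, hgφ⟩ := hφ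
  refine mem_of_isClosed M ?_ ?_
  · rintro _ ⟨t, _, rfl⟩
    exact hgφ t ▸ (g t).val_mem
  · convert (hC.isCompact.image hg).isClosed using 1
    ext x
    constructor
    · rintro ⟨t, ht, h⟩
      exact ⟨t, ht, El.val_injective ((hgφ t).trans h)⟩
    · rintro ⟨t, ht, rfl⟩
      exact ⟨t, ht, (hgφ t).symm⟩

theorem Plot.range_mem [CompactSpace T] {φ : T → X.carrier} (hφ : X.Plot φ) :
    Set.range φ ∈ X.str.sets :=
  Set.image_univ ▸ hφ.image_mem isClosed_univ

theorem Plot.isClosed_eq {φ : S → X.carrier} {ψ : T → X.carrier} (hφ : X.Plot φ)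
    (hψ : X.Plot ψ) : IsClosed {p : S × T | φ p.1 = ψ p.2} := by
  obtain ⟨M, g, hg, hgφ⟩ := hφ
  obtain ⟨N, g', hN, hg', hgψ⟩ := hψ.exists_lift_ge M
  convert _root_.isClosed_eq
    (((El.isInducing_incl hN).continuous.comp hg).comp (continuous_fst (X := S) (Y := T)))
    (hg'.comp continuous_snd) using 1
  ext p
  simp only [Set.mem_ofPred_eq, ← hgφ, ← hgψ]
  exact El.val_injective.eq_iff (a := El.incl hN (g p.1))

/-- A continuous surjection from a compact to a Hausdorff space is closed, hence a quotient map. -/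
theorem Plot.of_surjective [CompactSpace S] [T2Space T] {q : S → T} (hq : Continuous q)
    (hs : Function.Surjective q) {φ : T → X.carrier} (hφ : X.Plot fun s => φ (q s)) :
    X.Plot φ := by
  obtain ⟨M, g, hg, hgφ⟩ := hφ
  have hM : ∀ t, φ t ∈ (M : Set X.carrier) := fun t => by
    obtain ⟨s, rfl⟩ := hs t
    have h : (g s).val = φ (q s) := hgφ s
    exact h ▸ (g s).val_mem
  refine ⟨M, fun t => El.mk (φ t) (hM t), ?_, fun _ => rfl⟩
  rw [(hq.isClosedMap.isQuotientMap hq hs).continuous_iff]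
  convert hg using 1
  funext s
  exact El.val_injective (hgφ s).symm

theorem Plot.sigma {J : Type*} [Finite J] {T : J → Type*} [∀ j, TopologicalSpace (T j)]
    {φ : ∀ j, T j → X.carrier} (hφ : ∀ j, X.Plot (φ j)) :
    X.Plot (fun t : Σ j, T j => φ t.1 t.2) := by
  choose M g hg hgφ using hφ
  obtain ⟨N, hN⟩ := exists_le_finite M
  refine ⟨N, fun t => El.incl (hN t.1) (g t.1 t.2), ?_, fun t => hgφ _ _⟩
  exact continuous_sigma fun j => (El.isInducing_incl (hN j)).continuous.comp (hg j)

theorem Plot.sumElim {φ : S → X.carrier} {ψ : T → X.carrier} (hφ : X.Plot φ) (hψ : X.Plot ψ) :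
    X.Plot (Sum.elim φ ψ) := by
  obtain ⟨M, g, hg, hgφ⟩ := hφ
  obtain ⟨N, g', hN, hg', hgψ⟩ := hψ.exists_lift_ge M
  refine ⟨N, Sum.elim (fun s => El.incl hN (g s)) g',
    ((El.isInducing_incl hN).continuous.comp hg).sumElim hg', ?_⟩
  rintro (s | t)
  · exact hgφ s
  · exact hgψ t

theorem Hom.plot (f : X ⟶ Y) {φ : T → X.carrier} (hφ : X.Plot φ) :
    Y.Plot (fun t => Hom.toFun f (φ t)) := by
  obtain ⟨M, g, hg, hgφ⟩ := hφ
  refine ⟨⟨_, Hom.image_mem f M M.2⟩, fun t => Set.imageFactorization (Hom.toFun f) M (g t), ?_, ?_⟩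
  · exact Continuous.comp (Y := X.El M) (Z := Y.El ⟨_, Hom.image_mem f M M.2⟩)
      (Hom.continuous_restrict f M M.2) hg
  · intro t
    exact congrArg (Hom.toFun f) (hgφ t)

/-- A map carrying the members to plots is a morphism. -/
def Hom.ofPlot (f : X.carrier → Y.carrier)
    (hf : ∀ K : X.str.sets, Y.Plot (fun x : X.El K => f x.val)) : X ⟶ Y :=
  have hmem : ∀ K ∈ X.str.sets, f '' K ∈ Y.str.sets := fun K hK => by
    convert (hf ⟨K, hK⟩).range_mem using 1
    ext y
    constructor
    · rintro ⟨x, hx, rfl⟩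
      exact ⟨⟨x, hx⟩, rfl⟩
    · rintro ⟨x, rfl⟩
      exact ⟨x.val, x.val_mem, rfl⟩
  { toFun := f
    image_mem := hmem
    continuous_restrict := fun K hK =>
      (hf ⟨K, hK⟩).continuous_codRestrict ⟨_, hmem K hK⟩
        fun x => Set.mem_image_of_mem f x.val_mem }

theorem hom_ext {f g : X ⟶ Y} (h : ∀ x, Hom.toFun f x = Hom.toFun g x) : f = g :=
  Hom.ext (funext h)

theorem comp_toFun {Z : Cmp.{u}} (f : X ⟶ Y) (g : Y ⟶ Z) (x : X.carrier) :
    Hom.toFun (f ≫ g) x = Hom.toFun g (Hom.toFun f x) := rfl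

theorem id_toFun (x : X.carrier) : Hom.toFun (𝟙 X) x = x := rfl

theorem toFun_congr {f g : X ⟶ Y} (h : f = g) (x : X.carrier) : Hom.toFun f x = Hom.toFun g x :=
  h ▸ rfl

end Plot

end Cmp

/-! ### Compactologies from atlases -/

open scoped Topology

theorem TopologicalSpace.eq_of_le_of_compact_of_t2 {α : Type*} {τ σ : TopologicalSpace α}
    (h : τ ≤ σ) (hτ : @CompactSpace α τ) (hσ : @T2Space α σ) : τ = σ := by
  refine le_antisymm h (continuous_id_iff_le.mp ?_)
  have hc : @Continuous α α τ σ id := continuous_id_iff_le.mpr h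
  exact @Continuous.continuous_symm_of_equiv_compact_to_t2 α α τ σ hτ hσ (Equiv.refl α) hc

/-- A family of compact Hausdorff spaces mapping to a set, from which a compactology arises. -/
structure Atlas (Z : Type u) where
  /-- The index set of the charts. -/
  ι : Type u
  /-- The domains of the charts. -/
  dom : ι → Type u
  [top : ∀ i, TopologicalSpace (dom i)]
  [compactSpace : ∀ i, CompactSpace (dom i)]
  [t2Space : ∀ i, T2Space (dom i)]
  /-- The charts. -/
  chart : ∀ i, dom i → Z
  nonempty : Nonempty ι
  covers : ∀ z, ∃ i t, chart i t = z
  isClosed_ker : ∀ i, IsClosed {p : dom i × dom i | chart i p.1 = chart i p.2}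
  directed : ∀ i j, ∃ k,
    (∃ a : dom i → dom k, Continuous a ∧ ∀ t, chart k (a t) = chart i t) ∧
    (∃ b : dom j → dom k, Continuous b ∧ ∀ t, chart k (b t) = chart j t)

namespace Atlas

attribute [instance] top compactSpace t2Space

variable {Z : Type u} (A : Atlas Z)

/-- The topology on `Z` coinduced by a chart. -/
@[reducible]
def coind (i : A.ι) : TopologicalSpace Z := (A.top i).coinduced (A.chart i)

/-- The topology that a chart induces on a subset of `Z`. -/
@[reducible]
def topOn (i : A.ι) (S : Set Z) : TopologicalSpace S := (A.coind i).induced Subtype.val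

theorem isOpen_coind {i : A.ι} {U : Set Z} :
    IsOpen[A.coind i] U ↔ IsOpen (A.chart i ⁻¹' U) := isOpen_coinduced

theorem isClosed_coind {i : A.ι} {U : Set Z} :
    IsClosed[A.coind i] U ↔ IsClosed (A.chart i ⁻¹' U) := isClosed_coinduced

/-- The saturation is the projection of a closed part of the compact kernel relation. -/
theorem isClosed_saturation (i : A.ι) {C : Set (A.dom i)} (hC : IsClosed C) :
    IsClosed (A.chart i ⁻¹' (A.chart i '' C)) := by
  have h := ((A.isClosed_ker i).inter (hC.preimage continuous_fst)).isCompact.image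
    (continuous_snd (X := A.dom i) (Y := A.dom i))
  convert h.isClosed using 1
  ext t
  constructor
  · rintro ⟨s, hs, hst⟩
    exact ⟨(s, t), ⟨hst, hs⟩, rfl⟩
  · rintro ⟨⟨s, t⟩, ⟨hst, hs⟩, rfl⟩
    exact ⟨s, hs, hst⟩

theorem isClosed_fiber (i : A.ι) (z : Z) (hz : z ∈ Set.range (A.chart i)) :
    IsClosed (A.chart i ⁻¹' {z}) := by
  obtain ⟨t, rfl⟩ := hz
  convert A.isClosed_saturation i (isClosed_singleton (x := t)) using 1
  rw [Set.image_singleton]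

theorem t2Space_topOn (i : A.ι) {S : Set Z} (hS : S ⊆ Set.range (A.chart i)) :
    @T2Space S (A.topOn i S) := by
  let _ := A.topOn i S
  refine ⟨fun x y hxy => ?_⟩
  obtain ⟨U, V, hU, hV, hxU, hyV, hUV⟩ := normal_separation
    (A.isClosed_fiber i x (hS x.2)) (A.isClosed_fiber i y (hS y.2))
    (Set.disjoint_left.mpr fun t ht ht' => hxy (Subtype.ext (Eq.trans (Eq.symm ht) ht')))
  -- Points whose whole fibre lies in `W` form an open set, as saturations of closed sets are
  -- closed. This turns separated fibres into separated points.
  have key : ∀ W : Set (A.dom i), IsOpen W →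
      IsOpen[A.topOn i S] (Subtype.val ⁻¹' (A.chart i '' Wᶜ)ᶜ) := fun W hW =>
    isOpen_induced (t := A.coind i) (A.isOpen_coind.mpr
      (A.isClosed_saturation i hW.isClosed_compl).isOpen_compl)
  refine ⟨_, _, key U hU, key V hV, ?_, ?_, ?_⟩
  · rintro ⟨t, ht, h⟩
    exact ht (hxU h)
  · rintro ⟨t, ht, h⟩
    exact ht (hyV h)
  · refine Set.disjoint_left.mpr fun z hz hz' => ?_
    obtain ⟨t, ht⟩ := hS z.2
    have h₁ : t ∈ U := by
      by_contra h
      exact hz ⟨t, h, ht⟩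
    have h₂ : t ∈ V := by
      by_contra h
      exact hz' ⟨t, h, ht⟩
    exact Set.disjoint_left.mp hUV h₁ h₂

theorem compactSpace_topOn (i : A.ι) {C : Set (A.dom i)} (hC : IsClosed C) :
    @CompactSpace (A.chart i '' C) (A.topOn i _) := by
  let _ := A.coind i
  refine isCompact_iff_compactSpace.mp (hC.isCompact.image ?_)
  exact continuous_coinduced_rng

theorem coind_le {i k : A.ι} {a : A.dom i → A.dom k} (ha : Continuous a)
    (h : ∀ t, A.chart k (a t) = A.chart i t) : A.coind i ≤ A.coind k := by
  intro U hU
  have hU' := (A.isOpen_coind.mp hU).preimage ha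
  refine A.isOpen_coind.mpr ?_
  convert hU' using 1
  ext t
  simp [h]

theorem topOn_eq_of_map {i k : A.ι} {a : A.dom i → A.dom k} (ha : Continuous a)
    (h : ∀ t, A.chart k (a t) = A.chart i t) {S : Set Z} (hS : S ⊆ Set.range (A.chart i)) :
    A.topOn i S = A.topOn k S := by
  -- `S` need not be compact, so the topologies are first compared on the whole range of chart `i`,
  -- where the finer one is compact and the coarser one Hausdorff.
  have hr : A.topOn i (Set.range (A.chart i)) = A.topOn k (Set.range (A.chart i)) := by
    refine TopologicalSpace.eq_of_le_of_compact_of_t2 (induced_mono (A.coind_le ha h)) ?_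
      (A.t2Space_topOn k ?_)
    · rw [← Set.image_univ]
      exact A.compactSpace_topOn i isClosed_univ
    · rintro _ ⟨t, rfl⟩
      exact ⟨a t, h t⟩
  have hi : ∀ j, A.topOn j S = (A.topOn j (Set.range (A.chart i))).induced (Set.inclusion hS) :=
    fun j => by rw [topOn, topOn, induced_compose]; rfl
  rw [hi i, hi k, hr]

theorem topOn_eq (i j : A.ι) {S : Set Z} (hi : S ⊆ Set.range (A.chart i))
    (hj : S ⊆ Set.range (A.chart j)) : A.topOn i S = A.topOn j S := by
  obtain ⟨k, ⟨a, ha, hak⟩, ⟨b, hb, hbk⟩⟩ := A.directed i j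
  rw [A.topOn_eq_of_map ha hak hi, A.topOn_eq_of_map hb hbk hj]

/-- The members of the compactology of an atlas: the images of closed subsets of charts. -/
def sets : Set (Set Z) := {S | ∃ i, ∃ C : Set (A.dom i), IsClosed C ∧ A.chart i '' C = S}

theorem exists_subset_range (S : A.sets) : ∃ i, (S : Set Z) ⊆ Set.range (A.chart i) := by
  obtain ⟨_, i, C, _, rfl⟩ := S
  exact ⟨i, Set.image_subset_range _ _⟩

/-- The topology on a member. -/
@[reducible]
noncomputable def memTop (S : A.sets) : TopologicalSpace (S : Set Z) :=
  A.topOn (A.exists_subset_range S).choose S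

theorem memTop_eq (S : A.sets) {i : A.ι} (h : (S : Set Z) ⊆ Set.range (A.chart i)) :
    A.memTop S = A.topOn i S :=
  A.topOn_eq _ _ (A.exists_subset_range S).choose_spec h

theorem exists_range_subset_range (i j : A.ι) : ∃ k,
    Set.range (A.chart i) ⊆ Set.range (A.chart k) ∧
      Set.range (A.chart j) ⊆ Set.range (A.chart k) := by
  obtain ⟨k, ⟨a, _, hak⟩, ⟨b, _, hbk⟩⟩ := A.directed i j
  exact ⟨k, by rintro _ ⟨t, rfl⟩; exact ⟨a t, hak t⟩, by rintro _ ⟨t, rfl⟩; exact ⟨b t, hbk t⟩⟩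

/-- The compactology of an atlas. -/
noncomputable def compactology : Compactology Z where
  sets := A.sets
  top := A.memTop
  nonempty := ⟨_, A.nonempty.some, ∅, isClosed_empty, rfl⟩
  compactSpace := by
    rintro ⟨_, i, C, hC, rfl⟩
    rw [A.memTop_eq _ (Set.image_subset_range (A.chart i) C)]
    exact A.compactSpace_topOn i hC
  t2Space := fun S => A.t2Space_topOn _ (A.exists_subset_range S).choose_spec
  covers := by
    refine Set.eq_univ_of_forall fun z => ?_
    obtain ⟨i, t, rfl⟩ := A.covers z
    exact ⟨_, ⟨i, Set.univ, isClosed_univ, rfl⟩, t, trivial, rfl⟩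
  directed := by
    rintro _ ⟨i, C, _, rfl⟩ _ ⟨j, D, _, rfl⟩
    obtain ⟨k, hi, hj⟩ := A.exists_range_subset_range i j
    refine ⟨_, ⟨k, Set.univ, isClosed_univ, rfl⟩, ?_, ?_⟩ <;> rw [Set.image_univ]
    · exact (Set.image_subset_range _ _).trans hi
    · exact (Set.image_subset_range _ _).trans hj
  coherent := by
    intro K L h
    obtain ⟨i, hi⟩ := A.exists_subset_range K
    rw [A.memTop_eq K hi, A.memTop_eq L (h.trans hi), topOn, topOn, induced_compose]
    rfl
  mem_of_isCompact := by
    rintro ⟨_, i, C, hC, rfl⟩ L hL hcomp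
    have hS : A.chart i '' C ⊆ Set.range (A.chart i) := Set.image_subset_range _ _
    rw [A.memTop_eq _ hS] at hcomp
    have hcl := @IsCompact.isClosed _ (A.topOn i _) (A.t2Space_topOn i hS) _ hcomp
    obtain ⟨F, hF, hFL⟩ := (@isClosed_induced_iff _ _ (A.coind i) _ _).mp hcl
    refine ⟨i, C ∩ A.chart i ⁻¹' F, hC.inter (A.isClosed_coind.mp hF), ?_⟩
    have hiff : ∀ z (hz : z ∈ A.chart i '' C), z ∈ F ↔ z ∈ L := fun z hz =>
      Set.ext_iff.mp hFL ⟨z, hz⟩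
    ext z
    constructor
    · rintro ⟨t, ⟨htC, htF⟩, rfl⟩
      exact (hiff _ ⟨t, htC, rfl⟩).mp htF
    · intro hz
      obtain ⟨t, htC, rfl⟩ := hL hz
      exact ⟨t, ⟨htC, (hiff _ ⟨t, htC, rfl⟩).mpr hz⟩, rfl⟩

/-- The compactological set of an atlas. -/
noncomputable def toCmp : Cmp.{u} := ⟨Z, A.compactology⟩

theorem range_mem (i : A.ι) : Set.range (A.chart i) ∈ A.toCmp.str.sets :=
  ⟨i, Set.univ, isClosed_univ, Set.image_univ⟩

theorem plot_chart (i : A.ι) : A.toCmp.Plot (A.chart i) := by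
  have hmem := A.range_mem i
  refine ⟨⟨_, hmem⟩, Set.rangeFactorization (A.chart i), ?_, fun t => rfl⟩
  have h : (A.memTop ⟨_, hmem⟩) = _ := A.memTop_eq ⟨_, hmem⟩ subset_rfl
  change @Continuous _ _ _ (A.memTop ⟨_, hmem⟩) _
  rw [h]
  exact continuous_induced_rng.mpr continuous_coinduced_rng

/-- A map out of the set of an atlas which carries the charts to plots carries the members to
plots. -/
theorem plot_of_chart {Y : Cmp.{u}} (f : Z → Y.carrier) (hf : ∀ i, Y.Plot fun t => f (A.chart i t))
    (K : A.toCmp.str.sets) : Y.Plot (fun x : A.toCmp.El K => f x.val) := by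
  obtain ⟨i, hi⟩ := A.exists_subset_range K
  let L : A.toCmp.str.sets := ⟨_, A.range_mem i⟩
  have hq := (A.plot_chart i).continuous_codRestrict L fun t => Set.mem_range_self t
  have hL : Y.Plot (fun x : A.toCmp.El L => f x.val) := by
    refine Cmp.Plot.of_surjective hq ?_ (hf i)
    rintro ⟨_, t, rfl⟩
    exact ⟨t, rfl⟩
  exact hL.comp_continuous (Cmp.El.isInducing_incl (K := K) (L := L) hi).continuous

end Atlas

/-! ### Size bounds -/

/-- A class of types stable under subquotients and finite disjoint unions. -/
structure IsSizeClass (p : Type u → Prop) : Prop where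
  of_surjective : ∀ {α β : Type u} (S : Set α) (f : S → β), Function.Surjective f → p α → p β
  sum : ∀ {α β : Type u}, p α → p β → p (α ⊕ β)
  sigma : ∀ {J : Type} [Finite J] {α : J → Type u}, (∀ j, p (α j)) → p (Σ j, α j)

theorem Atlas.size_of_mem {Z : Type u} (A : Atlas Z) {p : Type u → Prop} (hp : IsSizeClass p)
    (h : ∀ i, p (A.dom i)) : ∀ K ∈ A.toCmp.str.sets, p K := by
  rintro _ ⟨i, C, _, rfl⟩
  exact hp.of_surjective C (Set.imageFactorization (A.chart i) C) Set.imageFactorization_surjective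
    (h i)

namespace Cmp

/-! ### Closed embeddings and equalizers -/

section ClosedEmbedding

variable {X Y Z : Cmp.{u}}

/-- An injective morphism for which the preimages of members are members. -/
structure IsClosedEmb (i : X ⟶ Y) : Prop where
  injective : Function.Injective (Hom.toFun i)
  preimage_mem : ∀ K ∈ Y.str.sets, Hom.toFun i ⁻¹' K ∈ X.str.sets

/-- Preimages of members are always closed in members; only a bound by some member has to be
supplied. -/
theorem preimage_mem_of_subset (f : X ⟶ Y) {M : Set Y.carrier} (hM : M ∈ Y.str.sets)
    {N : Set X.carrier} (hN : N ∈ X.str.sets) (h : Hom.toFun f ⁻¹' M ⊆ N) :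
    Hom.toFun f ⁻¹' M ∈ X.str.sets :=
  mem_of_isClosed ⟨N, hN⟩ h ((Hom.plot f (X.plot_val ⟨N, hN⟩)).isClosed_preimage ⟨M, hM⟩)

theorem IsClosedEmb.of_comp {f : X ⟶ Y} {g : Y ⟶ Z} (h : IsClosedEmb (f ≫ g)) :
    IsClosedEmb f where
  injective := fun _ _ hxy => h.injective (congrArg (Hom.toFun g) hxy)
  preimage_mem := fun K hK => preimage_mem_of_subset f hK
    (h.preimage_mem _ (Hom.image_mem g K hK)) fun _ hx => ⟨_, hx, rfl⟩

theorem IsClosedEmb.exists_lift {i : X ⟶ Y} (hi : IsClosedEmb i) (h : Z ⟶ Y)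
    (H : ∀ z, ∃ x, Hom.toFun i x = Hom.toFun h z) : ∃ l : Z ⟶ X, l ≫ i = h := by
  choose l hl using H
  refine ⟨Hom.ofPlot l fun K => ?_, hom_ext hl⟩
  let L : X.str.sets := ⟨_, hi.preimage_mem _ (Hom.image_mem h K K.2)⟩
  have hcl := (Hom.plot h (Z.plot_val K)).isClosed_eq (Hom.plot i (X.plot_val L))
  -- This fibre product is compact and projects onto `K`. Since `i` is injective, the lift composed
  -- with this projection is the other projection, a plot, so the lift is a plot on `K`.
  let S := {p : Z.El K × X.El L // Hom.toFun h p.1.val = Hom.toFun i p.2.val}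
  have : CompactSpace S := isCompact_iff_compactSpace.mp hcl.isCompact
  refine Plot.of_surjective (S := S) (q := fun p => p.1.1)
    (continuous_fst.comp continuous_subtype_val) ?_ ?_
  · intro x
    have hx : l x.val ∈ (L : Set X.carrier) := ⟨x.val, x.val_mem, (hl x.val).symm⟩
    exact ⟨⟨(x, El.mk _ hx), (hl x.val).symm⟩, rfl⟩
  · convert (X.plot_val L).comp_continuous (h := fun p : S => p.1.2)
      (continuous_snd.comp continuous_subtype_val) using 1
    funext p
    exact hi.injective ((hl _).trans p.2)

/-- Equalizers are closed embeddings. -/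
theorem exists_isClosedEmb_equalizer (f g : X ⟶ Y) :
    ∃ (E : Cmp.{u}) (e : E ⟶ X), e ≫ f = e ≫ g ∧ IsClosedEmb e ∧
      (∀ x, Hom.toFun f x = Hom.toFun g x → ∃ y, Hom.toFun e y = x) ∧
      ∀ p : Type u → Prop, IsSizeClass p → (∀ K ∈ X.str.sets, p K) → ∀ K ∈ E.str.sets, p K := by
  have hcl : ∀ K : X.str.sets,
      IsClosed {x : X.El K | Hom.toFun f x.val = Hom.toFun g x.val} := fun K =>
    ((Hom.plot f (X.plot_val K)).isClosed_eq (Hom.plot g (X.plot_val K))).preimage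
      (continuous_id.prodMk continuous_id)
  let A : Atlas {x : X.carrier // Hom.toFun f x = Hom.toFun g x} :=
    { ι := X.str.sets
      dom := fun K => {x : X.El K // Hom.toFun f x.val = Hom.toFun g x.val}
      compactSpace := fun K => isCompact_iff_compactSpace.mp (hcl K).isCompact
      chart := fun K x => ⟨x.1.val, x.2⟩
      nonempty := ⟨⟨_, X.str.nonempty.some_mem⟩⟩
      covers := fun z => by
        obtain ⟨K, hK⟩ := exists_mem z.1
        exact ⟨K, ⟨El.mk z.1 hK, z.2⟩, rfl⟩
      isClosed_ker := fun K => by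
        convert isClosed_diagonal (X := {x : X.El K // Hom.toFun f x.val = Hom.toFun g x.val})
        ext ⟨x, y⟩
        exact ⟨fun h => Subtype.ext (El.val_injective (Subtype.mk.inj h)),
          fun h => by obtain rfl : x = y := h; rfl⟩
      directed := fun K L => by
        obtain ⟨M, hK, hL⟩ := exists_le_le K L
        refine ⟨M, ⟨fun x => ⟨El.incl hK x.1, x.2⟩, ?_, fun _ => rfl⟩,
          ⟨fun x => ⟨El.incl hL x.1, x.2⟩, ?_, fun _ => rfl⟩⟩
        · exact ((El.isInducing_incl hK).continuous.comp continuous_subtype_val).subtype_mk _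
        · exact ((El.isInducing_incl hL).continuous.comp continuous_subtype_val).subtype_mk _ }
  let e : A.toCmp ⟶ X := Hom.ofPlot Subtype.val
    (A.plot_of_chart (Y := X) Subtype.val fun K =>
      (X.plot_val K).comp_continuous continuous_subtype_val)
  refine ⟨A.toCmp, e, hom_ext Subtype.property, ⟨Subtype.val_injective, fun K hK => ?_⟩,
    fun x hx => ⟨⟨x, hx⟩, rfl⟩, fun p hp hX => A.size_of_mem hp fun K => ?_⟩
  · let k : A.ι := ⟨K, hK⟩
    suffices h : Hom.toFun e ⁻¹' K = Set.range (A.chart k) from h ▸ A.range_mem k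
    ext z
    constructor
    · intro hz
      exact ⟨⟨El.mk z.1 hz, z.2⟩, rfl⟩
    · rintro ⟨x, rfl⟩
      exact x.1.val_mem
  · exact hp.of_surjective (α := (K : Set X.carrier)) _ _ Function.surjective_id (hX K K.2)

end ClosedEmbedding

/-! ### Gluing along a closed embedding -/

section Amalgam

variable {A B C : Cmp.{u}} (i : A ⟶ B) (f : A ⟶ C)

/-- The relation gluing `B` to `C` along an injective map `i` from `A` to `B`. -/
def glueSetoid (hi : Function.Injective (Hom.toFun i)) : Setoid (C.carrier ⊕ B.carrier) where
  r s t := s = t ∨ ∃ x y : C.carrier ⊕ A.carrier,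
    Sum.map id (Hom.toFun i) x = s ∧ Sum.map id (Hom.toFun i) y = t ∧
      Sum.elim id (Hom.toFun f) x = Sum.elim id (Hom.toFun f) y
  iseqv := by
    refine ⟨fun s => Or.inl rfl, ?_, ?_⟩
    · rintro s t (rfl | ⟨x, y, hx, hy, h⟩)
      · exact Or.inl rfl
      · exact Or.inr ⟨y, x, hy, hx, h.symm⟩
    · rintro s t w (rfl | ⟨x, y, hx, hy, h⟩) (rfl | ⟨x', y', hx', hy', h'⟩)
      · exact Or.inl rfl
      · exact Or.inr ⟨x', y', hx', hy', h'⟩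
      · exact Or.inr ⟨x, y, hx, hy, h⟩
      -- Injectivity of `i` makes the relation transitive without passing to a generated equivalence
      -- relation.
      · obtain rfl : y = x' := Function.Injective.sumMap Function.injective_id hi (hy.trans hx'.symm)
        exact Or.inr ⟨x, y', hx, hy', h.trans h'⟩

variable {i}

/-- As `i` is a closed embedding, the part of `A` over `L` is a member `M`. The relation is the
diagonal together with the image of a closed, hence compact, relation on `K ⊔ M`. -/
theorem isClosed_glue (hi : IsClosedEmb i) (K : C.str.sets) (L : B.str.sets) :
    IsClosed {p : (C.El K ⊕ B.El L) × (C.El K ⊕ B.El L) |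
      glueSetoid i f hi.injective (Sum.map El.val El.val p.1) (Sum.map El.val El.val p.2)} := by
  let M : A.str.sets := ⟨_, hi.preimage_mem L L.2⟩
  let j : C.El K ⊕ A.El M → C.El K ⊕ B.El L :=
    Sum.map id fun a => El.mk (Hom.toFun i a.val) a.val_mem
  have hj : Continuous j := continuous_id.sumMap
    ((Hom.plot i (A.plot_val M)).continuous_codRestrict L fun a => a.val_mem)
  let φ : C.El K ⊕ A.El M → C.carrier := Sum.elim El.val fun a => Hom.toFun f a.val
  have hφ : C.Plot φ := (C.plot_val K).sumElim (Hom.plot f (A.plot_val M))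
  convert isClosed_diagonal.union
    (((hφ.isClosed_eq hφ).isCompact.image (hj.prodMap hj)).isClosed) using 1
  have hv : Function.Injective (Sum.map El.val El.val : C.El K ⊕ B.El L → _) :=
    Function.Injective.sumMap El.val_injective El.val_injective
  have lift : ∀ (x : C.carrier ⊕ A.carrier) (s : C.El K ⊕ B.El L),
      Sum.map id (Hom.toFun i) x = Sum.map El.val El.val s →
      ∃ x' : C.El K ⊕ A.El M, j x' = s ∧ φ x' = Sum.elim id (Hom.toFun f) x := by
    rintro (c | a) (s | s) h
    · exact ⟨Sum.inl s, rfl, (Sum.inl_injective h).symm⟩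
    · cases h
    · cases h
    · have h' : Hom.toFun i a = s.val := Sum.inr_injective h
      have ha : a ∈ (M : Set A.carrier) := by
        change Hom.toFun i a ∈ (L : Set B.carrier)
        exact h' ▸ s.val_mem
      exact ⟨Sum.inr (El.mk a ha), congrArg Sum.inr (El.val_injective h'), rfl⟩
  have unlift : ∀ x : C.El K ⊕ A.El M,
      Sum.map id (Hom.toFun i) (Sum.map El.val El.val x) = Sum.map El.val El.val (j x) ∧
        Sum.elim id (Hom.toFun f) (Sum.map El.val El.val x) = φ x := by
    rintro (c | a) <;> exact ⟨rfl, rfl⟩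
  ext ⟨s, t⟩
  constructor
  · rintro (h | ⟨x, y, hx, hy, h⟩)
    · exact Or.inl (hv h)
    · obtain ⟨x', rfl, hx'⟩ := lift x s hx
      obtain ⟨y', rfl, hy'⟩ := lift y t hy
      exact Or.inr ⟨(x', y'), hx'.trans (h.trans hy'.symm), rfl⟩
  · rintro (h | ⟨⟨x, y⟩, h, hxy⟩)
    · obtain rfl : s = t := h
      exact Or.inl rfl
    · obtain ⟨rfl, rfl⟩ := Prod.mk.inj hxy
      exact Or.inr ⟨_, _, (unlift x).1, (unlift y).1,
        (unlift x).2.trans (Eq.trans h (unlift y).2.symm)⟩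

/-- The atlas of the set obtained by gluing along a closed embedding. -/
def glueAtlas (hi : IsClosedEmb i) : Atlas (Quotient (glueSetoid i f hi.injective)) where
  ι := C.str.sets × B.str.sets
  dom := fun k => C.El k.1 ⊕ B.El k.2
  chart := fun k t => Quotient.mk _ (Sum.map El.val El.val t)
  nonempty := ⟨⟨_, C.str.nonempty.some_mem⟩, ⟨_, B.str.nonempty.some_mem⟩⟩
  covers := by
    rintro ⟨c | b⟩
    · obtain ⟨K, hK⟩ := exists_mem c
      exact ⟨(K, ⟨_, B.str.nonempty.some_mem⟩), Sum.inl (El.mk c hK), rfl⟩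
    · obtain ⟨K, hK⟩ := exists_mem b
      exact ⟨(⟨_, C.str.nonempty.some_mem⟩, K), Sum.inr (El.mk b hK), rfl⟩
  isClosed_ker := fun k => by
    convert isClosed_glue f hi k.1 k.2 using 1
    ext p
    exact Quotient.eq
  directed := fun k l => by
    obtain ⟨M, hM₁, hM₂⟩ := exists_le_le k.1 l.1
    obtain ⟨N, hN₁, hN₂⟩ := exists_le_le k.2 l.2
    refine ⟨(M, N), ⟨Sum.map (El.incl hM₁) (El.incl hN₁), ?_, ?_⟩,
      ⟨Sum.map (El.incl hM₂) (El.incl hN₂), ?_, ?_⟩⟩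
    · exact (El.isInducing_incl hM₁).continuous.sumMap (El.isInducing_incl hN₁).continuous
    · rintro (t | t) <;> rfl
    · exact (El.isInducing_incl hM₂).continuous.sumMap (El.isInducing_incl hN₂).continuous
    · rintro (t | t) <;> rfl

theorem plot_glue (hi : IsClosedEmb i) (K : C.str.sets) (L : B.str.sets) :
    (glueAtlas f hi).toCmp.Plot fun t : C.El K ⊕ B.El L =>
      Quotient.mk (glueSetoid i f hi.injective) (Sum.map El.val El.val t) :=
  (glueAtlas f hi).plot_chart (K, L)

/-- A closed embedding and a morphism with the same source can be completed to a commutative square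
whose side opposite to the closed embedding is a closed embedding, and in which nothing but the
image of the common source is identified. -/
theorem exists_amalgam (hi : IsClosedEmb i) :
    ∃ (P : Cmp.{u}) (inl : C ⟶ P) (inr : B ⟶ P), f ≫ inl = i ≫ inr ∧ IsClosedEmb inl ∧
      (∀ c b, Hom.toFun inl c = Hom.toFun inr b → ∃ a, Hom.toFun f a = c ∧ Hom.toFun i a = b) ∧
      ∀ p : Type u → Prop, IsSizeClass p → (∀ K ∈ C.str.sets, p K) → (∀ K ∈ B.str.sets, p K) →
        ∀ K ∈ P.str.sets, p K := by
  let Q := glueAtlas f hi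
  let inl : C ⟶ Q.toCmp := Hom.ofPlot (fun c => Quotient.mk _ (Sum.inl c)) fun K =>
    (plot_glue f hi K ⟨_, B.str.nonempty.some_mem⟩).comp_continuous continuous_inl
  let inr : B ⟶ Q.toCmp := Hom.ofPlot (fun b => Quotient.mk _ (Sum.inr b)) fun K =>
    (plot_glue f hi ⟨_, C.str.nonempty.some_mem⟩ K).comp_continuous continuous_inr
  have hlr : ∀ c b, Hom.toFun inl c = Hom.toFun inr b →
      ∃ a, Hom.toFun f a = c ∧ Hom.toFun i a = b := by
    intro c b h
    rcases Quotient.exact h with h | ⟨x, y, hx, hy, hxy⟩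
    · cases h
    · rcases x with x | x <;> rcases y with y | y
      · cases hy
      · exact ⟨y, hxy.symm.trans (Sum.inl_injective hx), Sum.inr_injective hy⟩
      · cases hx
      · cases hx
  have hinl : Function.Injective (Hom.toFun inl) := by
    intro c c' h
    rcases Quotient.exact h with h | ⟨x, y, hx, hy, hxy⟩
    · exact Sum.inl_injective h
    · rcases x with x | x <;> rcases y with y | y
      · exact (Sum.inl_injective hx).symm.trans (hxy.trans (Sum.inl_injective hy))
      · cases hy
      · cases hx
      · cases hx
  have hw : f ≫ inl = i ≫ inr := hom_ext fun a =>
    Quotient.sound (Or.inr ⟨Sum.inl (Hom.toFun f a), Sum.inr a, rfl, rfl, rfl⟩)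
  refine ⟨Q.toCmp, inl, inr, hw, ⟨hinl, fun M hM => ?_⟩, hlr, fun p hp hC hB =>
    Q.size_of_mem hp fun k => hp.sum (hC k.1 k.1.2) (hB k.2 k.2.2)⟩
  obtain ⟨⟨K, L⟩, hKL⟩ := Q.exists_subset_range ⟨M, hM⟩
  let N : A.str.sets := ⟨_, hi.preimage_mem L L.2⟩
  -- The preimage is bounded by the member `K ∪ f(i⁻¹(L))`.
  refine preimage_mem_of_subset inl hM
    ((C.plot_val K).sumElim (Hom.plot f (A.plot_val N))).range_mem fun c hc => ?_
  obtain ⟨t | t, ht⟩ := hKL hc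
  · exact ⟨Sum.inl t, hinl ht⟩
  · obtain ⟨a, rfl, ha⟩ := hlr c t.val ht.symm
    have haN : a ∈ (N : Set A.carrier) := by
      change Hom.toFun i a ∈ (L : Set B.carrier)
      exact ha ▸ t.val_mem
    exact ⟨Sum.inr (El.mk a haN), rfl⟩

end Amalgam

/-! ### Finite colimits -/

section Colimit

variable {J : Type} [SmallCategory J] (F : J ⥤ Cmp.{u})

/-- The inclusion of a disjoint union of members into the disjoint union of the objects of a
diagram. -/
def famVal {F : J ⥤ Cmp.{u}} {K : ∀ j, (F.obj j).str.sets} (t : Σ j, (F.obj j).El (K j)) :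
    Σ j, (F.obj j).carrier := ⟨t.1, t.2.val⟩

/-- The equivalence relations on the disjoint union of the objects of a diagram which are closed
and compatible with the transition maps. -/
structure IsAdmissible (r : Setoid (Σ j, (F.obj j).carrier)) : Prop where
  map : ∀ {j j' : J} (f : j ⟶ j') (x : (F.obj j).carrier), r ⟨j', Hom.toFun (F.map f) x⟩ ⟨j, x⟩
  isClosed : ∀ K : ∀ j, (F.obj j).str.sets,
    IsClosed {p : (Σ j, (F.obj j).El (K j)) × (Σ j, (F.obj j).El (K j)) |
      r (famVal p.1) (famVal p.2)}

/-- The least admissible equivalence relation. -/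
def colimSetoid : Setoid (Σ j, (F.obj j).carrier) := sInf {r | IsAdmissible F r}

/-- Both conditions survive intersections. The infimum is used because the relation generated by the
transition maps need not be closed. -/
theorem isAdmissible_colimSetoid : IsAdmissible F (colimSetoid F) where
  map f x := fun _ hr => hr.map f x
  isClosed K := by
    have h : IsClosed (⋂ r : {r // IsAdmissible F r},
        {p : (Σ j, (F.obj j).El (K j)) × (Σ j, (F.obj j).El (K j)) |
          r.1 (famVal p.1) (famVal p.2)}) := isClosed_iInter fun r => r.2.isClosed K
    convert h using 1
    ext p
    rw [Set.mem_iInter]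
    exact ⟨fun hp r => hp r.1 r.2, fun hp r hr => hp ⟨r, hr⟩⟩

/-- The choice of a member in each object of a diagram. -/
noncomputable def someFam (j : J) : (F.obj j).str.sets := ⟨_, (F.obj j).str.nonempty.some_mem⟩

theorem exists_fam {j : J} (L : (F.obj j).str.sets) :
    ∃ K : ∀ j, (F.obj j).str.sets, (L : Set (F.obj j).carrier) ⊆ K j := by
  classical
  exact ⟨Function.update (someFam F) j L, by rw [Function.update_self]⟩

variable [Finite J]

/-- The atlas of the colimit of a finite diagram. -/
noncomputable def colimAtlas : Atlas (Quotient (colimSetoid F)) where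
  ι := ∀ j, (F.obj j).str.sets
  dom := fun K => Σ j, (F.obj j).El (K j)
  chart := fun K t => Quotient.mk _ (famVal t)
  nonempty := ⟨someFam F⟩
  covers := by
    rintro ⟨j, x⟩
    obtain ⟨L, hL⟩ := exists_mem x
    obtain ⟨K, hK⟩ := exists_fam F L
    exact ⟨K, ⟨j, El.mk x (hK hL)⟩, rfl⟩
  isClosed_ker := fun K => by
    convert (isAdmissible_colimSetoid F).isClosed K using 1
    ext p
    exact Quotient.eq
  directed := fun K L => by
    choose M hK hL using fun j => exists_le_le (K j) (L j)
    refine ⟨M, ⟨Sigma.map id fun j => El.incl (hK j), ?_, fun _ => rfl⟩,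
      ⟨Sigma.map id fun j => El.incl (hL j), ?_, fun _ => rfl⟩⟩
    · exact Continuous.sigma_map fun j => (El.isInducing_incl (hK j)).continuous
    · exact Continuous.sigma_map fun j => (El.isInducing_incl (hL j)).continuous

theorem plot_colim (K : ∀ j, (F.obj j).str.sets) :
    (colimAtlas F).toCmp.Plot fun t : Σ j, (F.obj j).El (K j) =>
      Quotient.mk (colimSetoid F) (famVal t) :=
  (colimAtlas F).plot_chart K

theorem exists_isColimit :
    ∃ c : Cocone F, Nonempty (IsColimit c) ∧ ∀ p : Type u → Prop, IsSizeClass p →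
      (∀ j, ∀ K ∈ (F.obj j).str.sets, p K) → ∀ K ∈ c.pt.str.sets, p K := by
  let Q := colimAtlas F
  let inj : ∀ j, F.obj j ⟶ Q.toCmp := fun j =>
    Hom.ofPlot (fun x => Quotient.mk _ ⟨j, x⟩) fun L => by
      obtain ⟨K, hK⟩ := exists_fam F L
      exact (plot_colim F K).comp_continuous (h := fun x => ⟨j, El.incl hK x⟩)
        (continuous_sigmaMk.comp (El.isInducing_incl hK).continuous)
  let c : Cocone F :=
    { pt := Q.toCmp
      ι :=
        { app := inj
          naturality := fun j j' f => hom_ext fun x =>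
            Quotient.sound ((isAdmissible_colimSetoid F).map f x) } }
  have hplot : ∀ (s : Cocone F) (K : ∀ j, (F.obj j).str.sets),
      s.pt.Plot fun t : Σ j, (F.obj j).El (K j) => Hom.toFun (s.ι.app t.1) t.2.val := fun s K =>
    Plot.sigma (φ := fun j (x : (F.obj j).El (K j)) => Hom.toFun (s.ι.app j) x.val) fun j =>
      Hom.plot (s.ι.app j) ((F.obj j).plot_val (K j))
  -- The kernel of any cocone is admissible, so it contains the least admissible relation; this is
  -- the universal property.
  have hadm : ∀ s : Cocone F, IsAdmissible F
      (Setoid.ker fun x : Σ j, (F.obj j).carrier => Hom.toFun (s.ι.app x.1) x.2) := fun s =>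
    ⟨fun f x => toFun_congr (s.w f) x, fun K => (hplot s K).isClosed_eq (hplot s K)⟩
  let desc : ∀ s : Cocone F, Q.toCmp ⟶ s.pt := fun s =>
    Hom.ofPlot (Quotient.lift (fun x : Σ j, (F.obj j).carrier => Hom.toFun (s.ι.app x.1) x.2)
      fun a b hab => hab _ (hadm s)) (Q.plot_of_chart _ fun K => hplot s K)
  refine ⟨c, ⟨{ desc := desc, fac := fun s j => rfl, uniq := fun s m hm => hom_ext ?_ }⟩,
    fun p hp h => Q.size_of_mem hp fun K => hp.sigma fun j => h j _ (K j).2⟩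
  rintro ⟨j, x⟩
  exact toFun_congr (hm j) x

end Colimit

/-! ### Regular monomorphisms and coregularity -/

section Coregular

variable {D : Type*} [Category D] (G : D ⥤ Cmp.{u}) [G.Full] [G.Faithful]

theorem nonempty_isLimit_fork {a b d : D} (i : a ⟶ b) (s t : b ⟶ d) (w : i ≫ s = i ≫ t)
    (hi : IsClosedEmb (G.map i))
    (h : ∀ x, Hom.toFun (G.map s) x = Hom.toFun (G.map t) x → ∃ y, Hom.toFun (G.map i) y = x) :
    Nonempty (IsLimit (Fork.ofι i w)) := by
  refine ⟨Fork.IsLimit.ofExistsUnique fun c => ?_⟩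
  obtain ⟨l, hl⟩ := hi.exists_lift (G.map c.ι) fun z => h _ (by
    rw [← comp_toFun, ← comp_toFun, ← G.map_comp, ← G.map_comp, c.condition])
  refine ⟨G.preimage l, G.map_injective ?_, fun m hm => G.map_injective (hom_ext fun x => ?_)⟩
  · rw [G.map_comp, G.map_preimage]
    exact hl
  · apply hi.injective
    rw [G.map_preimage, ← comp_toFun, ← comp_toFun, hl, ← G.map_comp]
    exact toFun_congr (congrArg G.map hm) x

variable {p : Type u → Prop} (hp : IsSizeClass p)
  (hG : ∀ X : Cmp.{u}, (∀ K ∈ X.str.sets, p K) → ∃ d, G.obj d = X)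
  (hG' : ∀ d, ∀ K ∈ (G.obj d).str.sets, p K)

include hp hG hG'

theorem exists_fork {a b : D} (s t : a ⟶ b) :
    ∃ (d : D) (e : d ⟶ a) (w : e ≫ s = e ≫ t), IsClosedEmb (G.map e) ∧
      (∀ x, Hom.toFun (G.map s) x = Hom.toFun (G.map t) x → ∃ y, Hom.toFun (G.map e) y = x) ∧
      Nonempty (IsLimit (Fork.ofι e w)) := by
  obtain ⟨E, e, w, he, h, hE⟩ := exists_isClosedEmb_equalizer (G.map s) (G.map t)
  obtain ⟨d, rfl⟩ := hG E (hE p hp (hG' a))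
  obtain ⟨e, rfl⟩ := G.map_surjective e
  have w' : e ≫ s = e ≫ t := G.map_injective (by simpa using w)
  exact ⟨d, e, w', he, h, nonempty_isLimit_fork G e s t w' he h⟩

theorem exists_amalgam_of_fullyFaithful {a b c : D} (i : a ⟶ b) (f : a ⟶ c)
    (hi : IsClosedEmb (G.map i)) :
    ∃ (d : D) (inl : c ⟶ d) (inr : b ⟶ d), f ≫ inl = i ≫ inr ∧ IsClosedEmb (G.map inl) ∧
      ∀ x y, Hom.toFun (G.map inl) x = Hom.toFun (G.map inr) y →
        ∃ z, Hom.toFun (G.map f) z = x ∧ Hom.toFun (G.map i) z = y := by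
  obtain ⟨P, inl, inr, w, hinl, h, hP⟩ := exists_amalgam (G.map f) hi
  obtain ⟨d, rfl⟩ := hG P (hP p hp (hG' c) (hG' b))
  obtain ⟨inl, rfl⟩ := G.map_surjective inl
  obtain ⟨inr, rfl⟩ := G.map_surjective inr
  exact ⟨d, inl, inr, G.map_injective (by simpa using w), hinl, h⟩

/-- Forwards, `f` is compared with the explicit equalizer of the pair it equalizes. Backwards, `f`
equalizes the two maps into the amalgam of two copies of `b` along `a`. -/
theorem isRegularMono_iff {a b : D} (f : a ⟶ b) :
    IsRegularMono f ↔ IsClosedEmb (G.map f) := by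
  constructor
  · rintro ⟨⟨r⟩⟩
    obtain ⟨d, e, w, he, h, -⟩ := exists_fork G hp hG hG' r.left r.right
    obtain ⟨l, hl⟩ := r.lift' e w
    obtain ⟨m, hm⟩ := he.exists_lift (G.map f) fun x => h _ (by
      rw [← comp_toFun, ← comp_toFun, ← G.map_comp, ← G.map_comp, r.w])
    obtain ⟨m, rfl⟩ := G.map_surjective m
    have hm' : m ≫ e = f := G.map_injective (by simpa using hm)
    have := r.mono
    have hml : m ≫ l = 𝟙 a := by rw [← cancel_mono f, Category.assoc, hl, hm', Category.id_comp]
    have hml' : ∀ x, Hom.toFun (G.map l) (Hom.toFun (G.map m) x) = x := fun x => by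
      rw [← comp_toFun, ← G.map_comp, hml, G.map_id, id_toFun]
    -- Since `l` is a retraction of `m`, the preimage of `K` under `f` lies in the image under `l`
    -- of its preimage under `e`, which is a member.
    refine ⟨fun x y hxy => ?_, fun K hK => preimage_mem_of_subset _ hK
      (Hom.image_mem (G.map l) _ (he.preimage_mem K hK)) fun x hx =>
        ⟨Hom.toFun (G.map m) x, ?_, hml' x⟩⟩
    · rw [← hm] at hxy
      exact (hml' x).symm.trans ((congrArg _ (he.injective hxy)).trans (hml' y))
    · rwa [← hm] at hx
  · intro hf
    obtain ⟨d, s, t, w, -, h⟩ := exists_amalgam_of_fullyFaithful G hp hG hG' f f hf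
    obtain ⟨hlim⟩ := nonempty_isLimit_fork G f s t w hf fun x hx => by
      obtain ⟨z, hz, -⟩ := h x x hx
      exact ⟨z, hz⟩
    exact ⟨⟨⟨d, s, t, w, hlim⟩⟩⟩

theorem isCoregular_of_fullyFaithful : IsCoregular D where
  hasFiniteColimits := by
    refine ⟨fun J _ _ => ⟨fun F => ?_⟩⟩
    obtain ⟨c, ⟨hc⟩, hsize⟩ := exists_isColimit (F ⋙ G)
    obtain ⟨d, hd⟩ := hG c.pt (hsize p hp fun j => hG' (F.obj j))
    -- The colimit taken in `Cmp` satisfies the size bound, so it already lies in the image of `G`.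
    have := createsColimitOfFullyFaithfulOfIso' hc d (eqToIso hd)
    have : HasColimit (F ⋙ G) := ⟨⟨c, hc⟩⟩
    exact hasColimit_of_created F G
  hasEqualizer_of_isCokernelPair := by
    intro X Y Z f s t _
    obtain ⟨d, e, w, -, -, ⟨h⟩⟩ := exists_fork G hp hG hG' s t
    exact ⟨⟨_, h⟩⟩
  regularMono_isStableUnderCobaseChange := by
    refine ⟨fun {A A' B B' f g f' g'} sq hf => ?_⟩
    have hf' := (isRegularMono_iff G hp hG hG' f).mp hf
    obtain ⟨d, inl, inr, w, h, -⟩ := exists_amalgam_of_fullyFaithful G hp hG hG' f g hf'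
    -- The amalgam need not be known to be the pushout: followed by the comparison map to it, `f'`
    -- becomes the closed embedding `inl`.
    refine (isRegularMono_iff G hp hG hG' f').mpr
      (IsClosedEmb.of_comp (g := G.map (sq.desc inl inr w)) ?_)
    rwa [← G.map_comp, sq.inl_desc]

end Coregular

/-! ### Cardinal bounds and conclusion -/

theorem isSizeClass_mk_lt {κ : Cardinal.{u}} (hκ : Cardinal.aleph0 ≤ κ) :
    IsSizeClass fun α : Type u => Cardinal.mk α < κ where
  of_surjective S f hf h :=
    ((Cardinal.mk_le_of_surjective hf).trans (Cardinal.mk_subtype_le _)).trans_lt h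
  sum h h' := by
    rw [Cardinal.mk_sum, Cardinal.lift_id, Cardinal.lift_id]
    exact Cardinal.add_lt_of_lt hκ h h'
  sigma {J} _ α h := by
    rcases isEmpty_or_nonempty J with hJ | hJ
    · rw [Cardinal.mk_eq_zero]
      exact Cardinal.aleph0_pos.trans_le hκ
    · obtain ⟨j₀, hj₀⟩ := Finite.exists_max fun j => Cardinal.mk (α j)
      rw [Cardinal.mk_sigma]
      refine (Cardinal.sum_le_sum _ (fun _ => Cardinal.mk (α j₀)) hj₀).trans_lt ?_
      rw [Cardinal.sum_const, Cardinal.lift_id']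
      refine Cardinal.mul_lt_of_lt hκ (lt_of_lt_of_le ?_ hκ) (h j₀)
      exact Cardinal.lift_lt_aleph0.mpr (Cardinal.mk_lt_aleph0 (α := J))

end Cmp

theorem mainTheorem10 :
    IsCoregular Cmp.{u} ∧
      ∀ κ : Cardinal.{u}, Cardinal.aleph0 < κ → κ.IsStrongLimit → IsCoregular (CmpSmall κ) := by
  refine ⟨?_, fun κ hκ _ => ?_⟩
  · exact Cmp.isCoregular_of_fullyFaithful (𝟭 Cmp.{u}) (p := fun _ => True)
      ⟨fun _ _ _ _ => trivial, fun _ _ => trivial, fun _ => trivial⟩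
      (fun X _ => ⟨X, rfl⟩) (fun _ _ _ => trivial)
  · exact Cmp.isCoregular_of_fullyFaithful (Cmp.isSmall κ).ι (Cmp.isSizeClass_mk_lt hκ.le)
      (fun X hX => ⟨⟨X, hX⟩, rfl⟩) (fun X => X.property)
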